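/- Let $d\ge 1$ and let $E\subset\mathbb{R}^d$. A cube is a set $Q=[a_1,b_1)\times\dots\times[a_d,b_d)$ with side length $\ell(Q)=b_1-a_1=\dots=b_d-a_d>0$; $|\cdot|$ is Lebesgue measure. For a cube $R$ let $\mathcal D(R)=\bigcup_{j\ge0}\mathcal D_j(R)$, where $\mathcal D_j(R)$ is the partition of $R$ into $2^{jd}$ cubes of side length $2^{-j}\ell(R)$. Let $\mathcal D(R,E)$ be the family of all $Q\in\mathcal D(R)$ with $Q\cap E\ne\emptyset$. Let $\mathcal F(R,E)$ be the family of all maximal $Q'\in\mathcal D(R)$ with $Q'\cap E=\emptyset$ (so $\mathcal F(R,E)=\{R\}$ if $R\cap E=\emptyset$). Let $M(R)$ be one of the largest cubes $Q\in\mathcal D(R)$ with $Q\cap E=\emptyset$, if there is any. Put $\mathcal D_0(R,E)=\{Q\in\mathcal D(R,E): |Q|\le|M(R)|\}$. The set $E$ is called weakly porous if there are constants $0<c,\delta<1$ such that for every cube $R$ the cube $M(R)$ exists and there is a finite family of pairwise disjoint cubes $Q\in\mathcal D(R)$ with $Q\cap E=\emptyset$ and $|Q|\ge\delta|M(R)|$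 whose total measure is at least $c|R|$. Theorem. The following are equivalent. (0) $E$ is weakly porous. (i) The closure of $E$ has Lebesgue measure zero, and there is a constant $C$ such that for every cube $R$ the cube $M(R)$ exists and $$\sum_{Q'\in\mathcal F(R,E)}|Q'|\log\frac1{\ell(Q')}\le\Big(\log\frac1{\ell(M(R))}+C\Big)|R| .$$ (ii) There is a constant $C$ such that for every cube $R$ the cube $M(R)$ exists and $$\sum_{Q\in\mathcal D(R,E)}|Q|\le\Big(\log_2\frac{\ell(R)}{\ell(M(R))}+C\Big)|R| .$$ (iii) There is a constant $C$ such that for every cube $R$ the cube $M(R)$ exists and $$\sum_{Q\in\mathcal D_0(R,E)}|Q|\le C|R| .$$ (iv) There is one constant $C$ such that for every cube $R$ the cube $M(R)$ exists and the three inequalities in (i), (ii) and (iii) all hold. In each of these inequalities the (possibly infinite) sum on the left is understood to be finite. -/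

import Mathlib

open MeasureTheory

/-- A half-open cube `[a₁, a₁ + ℓ) × ⋯ × [a_d, a_d + ℓ)` in `ℝ^d` with `ℓ > 0`. -/
structure Cube (d : ℕ) where
  corner : Fin d → ℝ
  side : ℝ
  side_pos : 0 < side

namespace Cube

variable {d : ℕ}

/-- The set of points of a cube. -/
def toSet (Q : Cube d) : Set (Fin d → ℝ) :=
  {x | ∀ i, Q.corner i ≤ x i ∧ x i < Q.corner i + Q.side}

/-- The Lebesgue measure `|Q|` of a cube. -/
noncomputable def vol (Q : Cube d) : ℝ := (volume Q.toSet).toReal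

theorem vol_eq (Q : Cube d) : Q.vol = Q.side ^ d := by
  have h : Q.toSet = Set.univ.pi fun i => Set.Ico (Q.corner i) (Q.corner i + Q.side) := by
    ext x
    simp [toSet]
  rw [vol, h, Real.volume_pi_Ico_toReal (fun i => by linarith [Q.side_pos])]
  simp

/-- The cubes of generation `j` in the dyadic decomposition of `R`: the `2 ^ (j * d)` cubes of
side length `2 ^ (-j) * ℓ(R)` obtained by cutting each side of `R` into `2 ^ j` equal parts. -/
def dyadicGen (R : Cube d) (j : ℕ) : Set (Cube d) :=
  {Q | Q.side = R.side / 2 ^ j ∧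
    ∃ k : Fin d → ℕ, ∀ i, k i < 2 ^ j ∧ Q.corner i = R.corner i + k i * (R.side / 2 ^ j)}

/-- The family `D(R)` of all dyadic cubes with respect to `R`. -/
def dyadic (R : Cube d) : Set (Cube d) := ⋃ j : ℕ, R.dyadicGen j

/-- The family `D(R, E)` of the dyadic cubes of `R` that intersect `E`. -/
def meeting (R : Cube d) (E : Set (Fin d → ℝ)) : Set (Cube d) :=
  {Q | Q ∈ R.dyadic ∧ (Q.toSet ∩ E).Nonempty}

/-- The family `F(R, E)` of the maximal dyadic cubes of `R` that do not intersect `E`. For a cube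
`Q ≠ R` maximality says that the dyadic parent of `Q` intersects `E`; if `R` itself does not
intersect `E`, then the only member is `R`. -/
def maximalFree (R : Cube d) (E : Set (Fin d → ℝ)) : Set (Cube d) :=
  {Q | Q ∈ R.dyadic ∧ Q.toSet ∩ E = ∅ ∧
    ∀ P ∈ R.dyadic, Q.toSet ⊂ P.toSet → (P.toSet ∩ E).Nonempty}

/-- `M` is one of the largest dyadic cubes of `R` that do not intersect `E`, that is, a possible
choice of `M(R)`. All such cubes have the same side length; there is none if `E` meets every
dyadic cube of `R`. -/
def IsLargestFree (R : Cube d) (E : Set (Fin d → ℝ)) (M : Cube d) : Prop :=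
  M ∈ R.dyadic ∧ M.toSet ∩ E = ∅ ∧ ∀ Q ∈ R.dyadic, Q.toSet ∩ E = ∅ → Q.side ≤ M.side

/-- The family `D₀(R, E)` of the cubes in `D(R, E)` with measure at most `|M|`. -/
def smallMeeting (R : Cube d) (E : Set (Fin d → ℝ)) (M : Cube d) : Set (Cube d) :=
  {Q | Q ∈ R.meeting E ∧ Q.vol ≤ M.vol}

end Cube

/-- Weakly porous sets. -/
def WeaklyPorous {d : ℕ} (E : Set (Fin d → ℝ)) : Prop :=
  ∃ c δ : ℝ, 0 < c ∧ c < 1 ∧ 0 < δ ∧ δ < 1 ∧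
    ∀ R : Cube d, ∃ M : Cube d, R.IsLargestFree E M ∧
      ∃ F : Finset (Cube d),
        (∀ Q ∈ F, Q ∈ R.dyadic ∧ Q.toSet ∩ E = ∅ ∧ δ * M.vol ≤ Q.vol) ∧
        (∀ Q ∈ F, ∀ Q' ∈ F, Q ≠ Q' → Disjoint Q.toSet Q'.toSet) ∧
        c * R.vol ≤ ∑ Q ∈ F, Q.vol

/-- The discrete BLO bound on `R` with constant `C`; the cube `M(R)` exists and the sum is
finite. -/
def DiscreteBLO {d : ℕ} (E : Set (Fin d → ℝ)) (C : ℝ) (R : Cube d) : Prop :=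
  ∃ M : Cube d, R.IsLargestFree E M ∧
    Summable (fun Q : R.maximalFree E => Q.1.vol * Real.log (1 / Q.1.side)) ∧
    ∑' Q : R.maximalFree E, Q.1.vol * Real.log (1 / Q.1.side)
      ≤ (Real.log (1 / M.side) + C) * R.vol

/-- The bound for all dyadic cubes of `R` that intersect `E`; the cube `M(R)` exists and the sum
is finite. The logarithm is binary. -/
def MeetingBound {d : ℕ} (E : Set (Fin d → ℝ)) (C : ℝ) (R : Cube d) : Prop :=
  ∃ M : Cube d, R.IsLargestFree E M ∧
    Summable (fun Q : R.meeting E => Q.1.vol) ∧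
    ∑' Q : R.meeting E, Q.1.vol ≤ (Real.logb 2 (R.side / M.side) + C) * R.vol

/-- The bound for the dyadic cubes of `R` that intersect `E` and are not larger than `M(R)`; the
cube `M(R)` exists and the sum is finite. -/
def SmallMeetingBound {d : ℕ} (E : Set (Fin d → ℝ)) (C : ℝ) (R : Cube d) : Prop :=
  ∃ M : Cube d, R.IsLargestFree E M ∧
    Summable (fun Q : R.smallMeeting E M => Q.1.vol) ∧
    ∑' Q : R.smallMeeting E M, Q.1.vol ≤ C * R.vol

/-!
Everything is expressed through two quantities attached to a cube `R`: the generation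
`p(R) = holeGen R E` of the largest free cube `M(R)`, so that `ℓ(M(R)) = ℓ(R) / 2 ^ p(R)`, and the
total volume `v_j(R) = meetVol R E j` of the dyadic cubes of generation `j` that meet `E`. The
sequence `v_j(R)` is decreasing in `j` and equals `|R|` for `j < p(R)`.

The three bounds are equivalent cube by cube. The sum over all cubes that meet `E` is `∑ v_j(R)`,
and the sum over those not larger than `M(R)` omits exactly the first `p(R)` terms, each equal to
`|R|` (`smallMeetingBound_iff_meetingBound`). If `v_j(R) → 0`, the maximal free cubes fill almost
all of `R`; those of generation `j + 1` have total volume `v_j(R) - v_{j+1}(R)`, and summation by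
parts turns the sum over the maximal free cubes into `∑ v_j(R)` (`discreteBLO_iff_meetingBound`).
The condition `v_j(R) → 0` for all `R` holds if and only if the closure of `E` is a null set
(`tendsto_meetVol`, `volume_closure_eq_zero`).

If `∑ v_j(R) ≤ (p(R) + C) |R|`, then by monotonicity `v_{p(R)+N}(R) ≤ |R| / 2` once `N ≥ 2 C`,
which is weak porosity (`weaklyPorous_of_meetingBound`).

For the converse, weak porosity of all cubes, not only the dyadic subcubes of a fixed one, gives
doubling: when a cube grows a little, its largest free cube grows at most by a constant factor
(`HoleCover.holeSide_le_of_slightly_larger`), since otherwise all the free cubes which fill a fixed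
proportion of the larger cube would be squeezed into a thin shell. Consequently
`p(Q) + 1 ≤ p(R) + a` for the dyadic children `Q` of `R`. Together with
`v_{p(R)+b}(R) ≤ (1 - c) |R|` this yields `∑_{j<n} v_j(R) ≤ t |R| + K v_t(R)` for all `t ≥ p(R)` by
induction on `n`, where `K = (a + b) / c` (`sum_range_meetVol_le`); take `t = p(R)`.
-/

/-! ### Dyadic subcubes -/

namespace Cube

variable {d : ℕ}

theorem ext_corner_side {Q P : Cube d} (hc : Q.corner = P.corner) (hs : Q.side = P.side) :
    Q = P := by
  cases Q; cases P; simp_all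

theorem toSet_eq_pi (Q : Cube d) :
    Q.toSet = Set.univ.pi fun i => Set.Ico (Q.corner i) (Q.corner i + Q.side) := by
  ext x
  simp [toSet]

theorem measurableSet_toSet (Q : Cube d) : MeasurableSet Q.toSet := by
  rw [toSet_eq_pi]
  exact MeasurableSet.univ_pi fun _ => measurableSet_Ico

theorem volume_toSet (Q : Cube d) : volume Q.toSet = ENNReal.ofReal (Q.side ^ d) := by
  rw [toSet_eq_pi, Real.volume_pi_Ico]
  simp [ENNReal.ofReal_pow Q.side_pos.le]

theorem volume_toSet_ne_top (Q : Cube d) : volume Q.toSet ≠ ⊤ := by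
  rw [volume_toSet]
  exact ENNReal.ofReal_ne_top

theorem vol_pos (Q : Cube d) : 0 < Q.vol := by
  rw [vol_eq]
  exact pow_pos Q.side_pos d

theorem corner_mem (Q : Cube d) : Q.corner ∈ Q.toSet := fun _ =>
  ⟨le_rfl, lt_add_of_pos_right _ Q.side_pos⟩

/-- The subcube of `R` of generation `j` with grid position `k`; it lies in `R` if all entries
of `k` are smaller than `2 ^ j`. -/
noncomputable def sub (R : Cube d) (j : ℕ) (k : Fin d → ℕ) : Cube d where
  corner i := R.corner i + k i * (R.side / 2 ^ j)
  side := R.side / 2 ^ j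
  side_pos := div_pos R.side_pos (by positivity)

/-- The dyadic cubes of generation `j`, as a finite set. -/
noncomputable def gen (R : Cube d) (j : ℕ) : Finset (Cube d) := by
  classical
  exact (Fintype.piFinset fun _ : Fin d => Finset.range (2 ^ j)).image (R.sub j)

theorem mem_gen_iff_exists {R Q : Cube d} {j : ℕ} :
    Q ∈ R.gen j ↔ ∃ k : Fin d → ℕ, (∀ i, k i < 2 ^ j) ∧ R.sub j k = Q := by
  simp [gen]

theorem mem_gen {R Q : Cube d} {j : ℕ} : Q ∈ R.gen j ↔ Q ∈ R.dyadicGen j := by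
  rw [mem_gen_iff_exists]
  constructor
  · rintro ⟨k, hk, rfl⟩
    exact ⟨rfl, k, fun i => ⟨hk i, rfl⟩⟩
  · rintro ⟨hs, k, hk⟩
    exact ⟨k, fun i => (hk i).1, ext_corner_side (funext fun i => (hk i).2.symm) hs.symm⟩

theorem mem_dyadic {R Q : Cube d} : Q ∈ R.dyadic ↔ ∃ j, Q ∈ R.gen j := by
  simp [dyadic, mem_gen]

theorem side_of_mem_gen {R Q : Cube d} {j : ℕ} (h : Q ∈ R.gen j) : Q.side = R.side / 2 ^ j :=
  (mem_gen.1 h).1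

theorem vol_of_mem_gen {R Q : Cube d} {j : ℕ} (h : Q ∈ R.gen j) :
    Q.vol = (R.side / 2 ^ j) ^ d := by
  rw [vol_eq, side_of_mem_gen h]

theorem sub_injective (R : Cube d) (j : ℕ) : Function.Injective (R.sub j) := by
  intro k l h
  funext i
  have h1 : R.corner i + k i * (R.side / 2 ^ j) = R.corner i + l i * (R.side / 2 ^ j) :=
    congrFun (congrArg corner h) i
  have h2 : 0 < R.side / 2 ^ j := div_pos R.side_pos (by positivity)
  exact_mod_cast mul_right_cancel₀ h2.ne' (add_left_cancel h1)

theorem card_gen (R : Cube d) (j : ℕ) : (R.gen j).card = (2 ^ j) ^ d := by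
  classical
  rw [gen, Finset.card_image_of_injective _ (R.sub_injective j)]
  simp

theorem sum_vol_gen (R : Cube d) (j : ℕ) : ∑ Q ∈ R.gen j, Q.vol = R.vol := by
  rw [Finset.sum_congr rfl fun Q hQ => vol_of_mem_gen hQ, Finset.sum_const, card_gen, vol_eq,
    nsmul_eq_mul, div_pow]
  push_cast
  field_simp

theorem gen_zero (R : Cube d) : R.gen 0 = {R} := by
  ext Q
  rw [mem_gen_iff_exists, Finset.mem_singleton]
  constructor
  · rintro ⟨k, hk, rfl⟩
    refine ext_corner_side (funext fun i => ?_) (by simp [sub])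
    have : k i = 0 := by simpa using hk i
    simp [sub, this]
  · rintro rfl
    exact ⟨0, by simp, ext_corner_side (funext fun i => by simp [sub]) (by simp [sub])⟩

theorem self_mem_gen_zero (R : Cube d) : R ∈ R.gen 0 := by
  simp [gen_zero]

theorem eq_of_mem_gen_gen {R Q : Cube d} {i j : ℕ} (hi : Q ∈ R.gen i) (hj : Q ∈ R.gen j) :
    i = j := by
  have h := (side_of_mem_gen hi).symm.trans (side_of_mem_gen hj)
  have hR := R.side_pos
  have h' : (2 : ℝ) ^ i = 2 ^ j := by
    field_simp at h
    exact h.symm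
  exact Nat.pow_right_injective le_rfl (by exact_mod_cast h')

theorem toSet_subset_of_mem_gen {R Q : Cube d} {j : ℕ} (h : Q ∈ R.gen j) :
    Q.toSet ⊆ R.toSet := by
  obtain ⟨k, hk, rfl⟩ := mem_gen_iff_exists.1 h
  intro x hx i
  have hx := hx i
  simp only [sub] at hx
  have hs : 0 < R.side / 2 ^ j := div_pos R.side_pos (by positivity)
  have h1 : (k i : ℝ) + 1 ≤ 2 ^ j := by exact_mod_cast hk i
  have h2 : ((k i : ℝ) + 1) * (R.side / 2 ^ j) ≤ R.side :=
    (mul_le_mul_of_nonneg_right h1 hs.le).trans_eq (by field_simp)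
  have h3 : 0 ≤ (k i : ℝ) * (R.side / 2 ^ j) := by positivity
  constructor <;> linarith

/-- Two cubes of the same generation with a common point coincide. -/
theorem eq_of_mem_gen_of_mem {R Q P : Cube d} {j : ℕ} (hQ : Q ∈ R.gen j) (hP : P ∈ R.gen j)
    {x : Fin d → ℝ} (hxQ : x ∈ Q.toSet) (hxP : x ∈ P.toSet) : Q = P := by
  obtain ⟨k, -, rfl⟩ := mem_gen_iff_exists.1 hQ
  obtain ⟨l, -, rfl⟩ := mem_gen_iff_exists.1 hP
  congr 1
  funext i
  have h1 := hxQ i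
  have h2 := hxP i
  simp only [sub] at h1 h2
  have hs : 0 < R.side / 2 ^ j := div_pos R.side_pos (by positivity)
  have h3 : (k i : ℝ) < l i + 1 := lt_of_mul_lt_mul_right (by linarith) hs.le
  have h4 : (l i : ℝ) < k i + 1 := lt_of_mul_lt_mul_right (by linarith) hs.le
  have h3' : k i < l i + 1 := by exact_mod_cast h3
  have h4' : l i < k i + 1 := by exact_mod_cast h4
  omega

theorem disjoint_of_mem_gen {R Q P : Cube d} {j : ℕ} (hQ : Q ∈ R.gen j) (hP : P ∈ R.gen j)
    (hne : Q ≠ P) : Disjoint Q.toSet P.toSet :=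
  Set.disjoint_left.2 fun _ hxQ hxP => hne (eq_of_mem_gen_of_mem hQ hP hxQ hxP)

theorem exists_mem_gen_of_mem {R : Cube d} {x : Fin d → ℝ} (hx : x ∈ R.toSet) (j : ℕ) :
    ∃ Q ∈ R.gen j, x ∈ Q.toSet := by
  have hs : 0 < R.side / 2 ^ j := div_pos R.side_pos (by positivity)
  have h0 : ∀ i, 0 ≤ (x i - R.corner i) / (R.side / 2 ^ j) := fun i =>
    div_nonneg (by linarith [(hx i).1]) hs.le
  refine ⟨R.sub j fun i => ⌊(x i - R.corner i) / (R.side / 2 ^ j)⌋₊,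
    mem_gen_iff_exists.2 ⟨_, fun i => ?_, rfl⟩, fun i => ?_⟩
  · rw [Nat.floor_lt (h0 i), div_lt_iff₀ hs]
    have : ((2 ^ j : ℕ) : ℝ) * (R.side / 2 ^ j) = R.side := by
      push_cast
      field_simp
    linarith [(hx i).2]
  · have h1 := (le_div_iff₀ hs).1 (Nat.floor_le (h0 i))
    have h2 := (div_lt_iff₀ hs).1 (Nat.lt_floor_add_one ((x i - R.corner i) / (R.side / 2 ^ j)))
    simp only [sub]
    constructor <;> linarith

theorem mem_gen_add {R Q P : Cube d} {i j : ℕ} (hP : P ∈ R.gen i) (hQ : Q ∈ P.gen j) :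
    Q ∈ R.gen (i + j) := by
  obtain ⟨k, hk, rfl⟩ := mem_gen_iff_exists.1 hP
  obtain ⟨l, hl, rfl⟩ := mem_gen_iff_exists.1 hQ
  refine mem_gen_iff_exists.2 ⟨fun n => 2 ^ j * k n + l n, fun n => ?_, ?_⟩
  · calc 2 ^ j * k n + l n < 2 ^ j * k n + 2 ^ j := Nat.add_lt_add_left (hl n) _
      _ = 2 ^ j * (k n + 1) := by ring
      _ ≤ 2 ^ j * 2 ^ i := Nat.mul_le_mul_left _ (hk n)
      _ = 2 ^ (i + j) := by ring
  · refine ext_corner_side (funext fun n => ?_) ?_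
    · simp only [sub]
      push_cast
      rw [pow_add]
      field_simp
      ring
    · simp only [sub]
      rw [pow_add]
      field_simp

/-- A cube of generation `i + j` that touches a cube of generation `i` is one of its dyadic
descendants. -/
theorem mem_gen_of_mem_gen_add {R Q P : Cube d} {i j : ℕ} (hP : P ∈ R.gen i)
    (hQ : Q ∈ R.gen (i + j)) {x : Fin d → ℝ} (hxP : x ∈ P.toSet) (hxQ : x ∈ Q.toSet) :
    Q ∈ P.gen j := by
  obtain ⟨Q', hQ', hx'⟩ := exists_mem_gen_of_mem hxP j
  rwa [eq_of_mem_gen_of_mem hQ (mem_gen_add hP hQ') hxQ hx']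

theorem gen_add_eq_biUnion [DecidableEq (Cube d)] (R : Cube d) (i j : ℕ) :
    R.gen (i + j) = (R.gen i).biUnion fun P => P.gen j := by
  ext Q
  rw [Finset.mem_biUnion]
  constructor
  · intro hQ
    obtain ⟨P, hP, hx⟩ := exists_mem_gen_of_mem (toSet_subset_of_mem_gen hQ Q.corner_mem) i
    exact ⟨P, hP, mem_gen_of_mem_gen_add hP hQ hx Q.corner_mem⟩
  · rintro ⟨P, hP, hQ⟩
    exact mem_gen_add hP hQ

theorem sum_gen_add (R : Cube d) (i j : ℕ) (f : Cube d → ℝ) :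
    ∑ Q ∈ R.gen (i + j), f Q = ∑ P ∈ R.gen i, ∑ Q ∈ P.gen j, f Q := by
  classical
  rw [gen_add_eq_biUnion, Finset.sum_biUnion]
  intro P hP P' hP' hne
  refine Finset.disjoint_left.2 fun Q hQ hQ' => hne ?_
  exact eq_of_mem_gen_of_mem hP hP' (toSet_subset_of_mem_gen hQ Q.corner_mem)
    (toSet_subset_of_mem_gen hQ' Q.corner_mem)

theorem side_le_side_iff {R Q P : Cube d} {i j : ℕ} (hQ : Q ∈ R.gen i) (hP : P ∈ R.gen j) :
    Q.side ≤ P.side ↔ j ≤ i := by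
  rw [side_of_mem_gen hQ, side_of_mem_gen hP,
    div_le_div_iff_of_pos_left R.side_pos (by positivity) (by positivity),
    pow_le_pow_iff_right₀ one_lt_two]

theorem vol_le_vol_iff (hd : 1 ≤ d) {Q P : Cube d} : Q.vol ≤ P.vol ↔ Q.side ≤ P.side := by
  rw [vol_eq, vol_eq, pow_le_pow_iff_left₀ Q.side_pos.le P.side_pos.le (by omega)]

/-! ### Volumes of disjoint families -/

theorem measureReal_biUnion_toSet {F : Finset (Cube d)}
    (hF : ∀ Q ∈ F, ∀ Q' ∈ F, Q ≠ Q' → Disjoint Q.toSet Q'.toSet) :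
    volume.real (⋃ Q ∈ F, Q.toSet) = ∑ Q ∈ F, Q.vol :=
  measureReal_biUnion_finset (fun Q hQ Q' hQ' hne => hF Q hQ Q' hQ' hne)
    (fun Q _ => Q.measurableSet_toSet) (fun Q _ => Q.volume_toSet_ne_top)

/-- Two disjoint families of disjoint cubes in `R` have total volume at most `|R|`. -/
theorem sum_vol_add_sum_vol_le {R : Cube d} {F G : Finset (Cube d)}
    (hF : ∀ Q ∈ F, ∀ Q' ∈ F, Q ≠ Q' → Disjoint Q.toSet Q'.toSet)
    (hG : ∀ Q ∈ G, ∀ Q' ∈ G, Q ≠ Q' → Disjoint Q.toSet Q'.toSet)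
    (hFG : ∀ Q ∈ F, ∀ P ∈ G, Disjoint Q.toSet P.toSet)
    (hFR : ∀ Q ∈ F, Q.toSet ⊆ R.toSet) (hGR : ∀ Q ∈ G, Q.toSet ⊆ R.toSet) :
    ∑ Q ∈ F, Q.vol + ∑ Q ∈ G, Q.vol ≤ R.vol := by
  have hF' : (⋃ Q ∈ F, Q.toSet) ⊆ R.toSet := Set.iUnion₂_subset hFR
  have hG' : (⋃ Q ∈ G, Q.toSet) ⊆ R.toSet := Set.iUnion₂_subset hGR
  rw [← measureReal_biUnion_toSet hF, ← measureReal_biUnion_toSet hG,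
    ← measureReal_union _ (Finset.measurableSet_biUnion _ fun Q _ => Q.measurableSet_toSet)
      (measure_ne_top_of_subset hF' R.volume_toSet_ne_top)
      (measure_ne_top_of_subset hG' R.volume_toSet_ne_top)]
  · exact measureReal_mono (Set.union_subset hF' hG') R.volume_toSet_ne_top
  · simp only [Set.disjoint_iUnion_left, Set.disjoint_iUnion_right]
    exact fun P hP Q hQ => hFG Q hQ P hP

end Cube

namespace Cube

variable {d : ℕ}

/-! ### Sums over families of dyadic cubes, generation by generation -/

/-- The members of generation `j` of a family of dyadic cubes of `R`, as a finite set. -/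
noncomputable def genIn (R : Cube d) (S : Set (Cube d)) (j : ℕ) : Finset (Cube d) := by
  classical
  exact (R.gen j).filter (· ∈ S)

theorem mem_genIn {R Q : Cube d} {S : Set (Cube d)} {j : ℕ} :
    Q ∈ R.genIn S j ↔ Q ∈ R.gen j ∧ Q ∈ S := by
  simp [genIn]

/-- A family of dyadic cubes of `R` is the disjoint union of its generations. -/
noncomputable def sigmaGenInEquiv {R : Cube d} {S : Set (Cube d)} (hS : S ⊆ R.dyadic) :
    (Σ j : ℕ, R.genIn S j) ≃ S :=
  Equiv.ofBijective (fun a => ⟨a.2.1, (mem_genIn.1 a.2.2).2⟩) <| by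
    constructor
    · rintro ⟨i, Q, hQ⟩ ⟨j, P, hP⟩ h
      obtain rfl : Q = P := congrArg Subtype.val h
      obtain rfl := eq_of_mem_gen_gen (mem_genIn.1 hQ).1 (mem_genIn.1 hP).1
      rfl
    · rintro ⟨Q, hQ⟩
      obtain ⟨j, hj⟩ := mem_dyadic.1 (hS hQ)
      exact ⟨⟨j, Q, mem_genIn.2 ⟨hj, hQ⟩⟩, rfl⟩

theorem summable_iff_summable_genIn {R : Cube d} {S : Set (Cube d)} (hS : S ⊆ R.dyadic)
    {f : Cube d → ℝ} (hf : ∀ Q ∈ S, 0 ≤ f Q) :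
    Summable (fun Q : S => f Q) ↔ Summable fun j => ∑ Q ∈ R.genIn S j, f Q := by
  rw [← (sigmaGenInEquiv hS).summable_iff, summable_sigma_of_nonneg]
  · simp only [Function.comp_apply, tsum_fintype]
    refine (and_iff_right fun j => Summable.of_finite).trans ?_
    refine iff_of_eq (congrArg (fun g : ℕ → ℝ => Summable g) (funext fun j => ?_))
    exact Finset.sum_coe_sort (R.genIn S j) f
  · exact fun a => hf _ (mem_genIn.1 a.2.2).2

theorem tsum_eq_tsum_genIn {R : Cube d} {S : Set (Cube d)} (hS : S ⊆ R.dyadic)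
    {f : Cube d → ℝ} (hf : Summable fun Q : S => f Q) :
    ∑' Q : S, f Q = ∑' j, ∑ Q ∈ R.genIn S j, f Q := by
  rw [← (sigmaGenInEquiv hS).tsum_eq]
  refine (Summable.tsum_sigma ((sigmaGenInEquiv hS).summable_iff.2 hf)).trans ?_
  refine tsum_congr fun j => ?_
  rw [tsum_fintype]
  exact Finset.sum_coe_sort (R.genIn S j) f

/-! ### The volume met by the set in each generation -/

/-- The total volume of the dyadic cubes of generation `j` that intersect `E`. -/
noncomputable def meetVol (R : Cube d) (E : Set (Fin d → ℝ)) (j : ℕ) : ℝ :=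
  ∑ Q ∈ R.genIn (R.meeting E) j, Q.vol

variable {R Q P : Cube d} {E : Set (Fin d → ℝ)} {i j : ℕ}

theorem mem_genIn_meeting :
    Q ∈ R.genIn (R.meeting E) j ↔ Q ∈ R.gen j ∧ (Q.toSet ∩ E).Nonempty := by
  rw [mem_genIn]
  exact ⟨fun h => ⟨h.1, h.2.2⟩, fun h => ⟨h.1, mem_dyadic.2 ⟨j, h.1⟩, h.2⟩⟩

theorem meetVol_eq_sum_ite [DecidablePred fun Q : Cube d => (Q.toSet ∩ E).Nonempty] :
    R.meetVol E j = ∑ Q ∈ R.gen j, if (Q.toSet ∩ E).Nonempty then Q.vol else 0 := by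
  rw [meetVol, ← Finset.sum_filter]
  congr 1
  ext Q
  rw [mem_genIn_meeting, Finset.mem_filter]

theorem meetVol_nonneg : 0 ≤ R.meetVol E j :=
  Finset.sum_nonneg fun Q _ => Q.vol_pos.le

theorem meetVol_le_vol : R.meetVol E j ≤ R.vol := by
  rw [← R.sum_vol_gen j]
  exact Finset.sum_le_sum_of_subset_of_nonneg (fun Q hQ => (mem_genIn.1 hQ).1)
    fun Q _ _ => Q.vol_pos.le

theorem meetVol_add : R.meetVol E (i + j) = ∑ P ∈ R.gen i, P.meetVol E j := by
  classical
  simp only [meetVol_eq_sum_ite, sum_gen_add]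

theorem meetVol_eq_vol (h : ∀ Q ∈ R.gen j, (Q.toSet ∩ E).Nonempty) : R.meetVol E j = R.vol := by
  classical
  rw [meetVol_eq_sum_ite, ← R.sum_vol_gen j]
  exact Finset.sum_congr rfl fun Q hQ => if_pos (h Q hQ)

theorem meetVol_eq_zero (h : R.toSet ∩ E = ∅) : R.meetVol E j = 0 := by
  refine Finset.sum_eq_zero fun Q hQ => ?_
  obtain ⟨hQ, x, hxQ, hxE⟩ := mem_genIn_meeting.1 hQ
  exact absurd (Set.mem_inter (toSet_subset_of_mem_gen hQ hxQ) hxE) (h ▸ Set.notMem_empty x)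

theorem meetVol_antitone : Antitone (R.meetVol E) := by
  classical
  refine antitone_nat_of_succ_le fun j => ?_
  rw [meetVol_add, meetVol_eq_sum_ite]
  refine Finset.sum_le_sum fun P _ => ?_
  split_ifs with h
  · exact meetVol_le_vol
  · exact (meetVol_eq_zero (Set.not_nonempty_iff_eq_empty.1 h)).le

theorem disjoint_of_mem_genIn {S : Set (Cube d)} :
    ∀ Q ∈ R.genIn S j, ∀ Q' ∈ R.genIn S j, Q ≠ Q' → Disjoint Q.toSet Q'.toSet :=
  fun _ hQ _ hQ' => disjoint_of_mem_gen (mem_genIn.1 hQ).1 (mem_genIn.1 hQ').1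

/-! ### The generation of the largest free cube -/

/-- The smallest generation that has a cube disjoint from `E`, so that
`ℓ(M(R)) = ℓ(R) / 2 ^ holeGen R E`; it is `0` if there is no such cube. -/
noncomputable def holeGen (R : Cube d) (E : Set (Fin d → ℝ)) : ℕ :=
  sInf {j | ∃ Q ∈ R.gen j, Q.toSet ∩ E = ∅}

theorem holeGen_le (hQ : Q ∈ R.gen j) (hE : Q.toSet ∩ E = ∅) : R.holeGen E ≤ j :=
  Nat.sInf_le ⟨Q, hQ, hE⟩

theorem meetVol_eq_vol_of_lt (h : j < R.holeGen E) : R.meetVol E j = R.vol := by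
  refine meetVol_eq_vol fun Q hQ => ?_
  by_contra hE
  exact h.not_ge (holeGen_le hQ (Set.not_nonempty_iff_eq_empty.1 hE))

theorem exists_mem_gen_holeGen (h : ∃ M, R.IsLargestFree E M) :
    ∃ Q ∈ R.gen (R.holeGen E), Q.toSet ∩ E = ∅ := by
  obtain ⟨M, hM, hE, -⟩ := h
  obtain ⟨j, hj⟩ := mem_dyadic.1 hM
  exact Nat.sInf_mem (s := {j | ∃ Q ∈ R.gen j, Q.toSet ∩ E = ∅}) ⟨j, M, hj, hE⟩

theorem IsLargestFree.mem_gen {M : Cube d} (h : R.IsLargestFree E M) :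
    M ∈ R.gen (R.holeGen E) := by
  obtain ⟨Q, hQ, hQE⟩ := exists_mem_gen_holeGen ⟨M, h⟩
  obtain ⟨j, hj⟩ := mem_dyadic.1 h.1
  have h1 := (side_le_side_iff hQ hj).1 (h.2.2 Q (mem_dyadic.2 ⟨_, hQ⟩) hQE)
  rwa [le_antisymm h1 (holeGen_le hj h.2.1)] at hj

theorem IsLargestFree.side_eq {M : Cube d} (h : R.IsLargestFree E M) :
    M.side = R.side / 2 ^ R.holeGen E :=
  side_of_mem_gen h.mem_gen

theorem IsLargestFree.logb_eq {M : Cube d} (h : R.IsLargestFree E M) :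
    Real.logb 2 (R.side / M.side) = R.holeGen E := by
  have hR := R.side_pos
  rw [h.side_eq, div_div_cancel₀ hR.ne', Real.logb_pow]
  simp

/-! ### The bounds in terms of generations -/

theorem meetingBound_iff {C : ℝ} :
    MeetingBound E C R ↔ (∃ M, R.IsLargestFree E M) ∧ Summable (R.meetVol E) ∧
      ∑' j, R.meetVol E j ≤ (R.holeGen E + C) * R.vol := by
  have hS : R.meeting E ⊆ R.dyadic := fun Q hQ => hQ.1
  have key := summable_iff_summable_genIn hS (f := vol) fun Q _ => Q.vol_pos.le
  constructor
  · rintro ⟨M, hM, h1, h2⟩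
    rw [tsum_eq_tsum_genIn hS h1, hM.logb_eq] at h2
    exact ⟨⟨M, hM⟩, key.1 h1, h2⟩
  · rintro ⟨⟨M, hM⟩, h1, h2⟩
    have h3 := key.2 h1
    refine ⟨M, hM, h3, ?_⟩
    rw [tsum_eq_tsum_genIn hS h3, hM.logb_eq]
    exact h2

/-- All cubes of generation less than `holeGen` meet `E`, so they contribute exactly
`holeGen * |R|` to the sum over all cubes that meet `E`. -/
theorem smallMeetingBound_iff_meetingBound (hd : 1 ≤ d) {C : ℝ} :
    SmallMeetingBound E C R ↔ MeetingBound E C R := by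
  have hS : ∀ M, R.smallMeeting E M ⊆ R.dyadic := fun M Q hQ => hQ.1.1
  have key := fun M => summable_iff_summable_genIn (hS M) (f := vol) fun Q _ => Q.vol_pos.le
  have hv : ∀ M, R.IsLargestFree E M → ∀ j, ∑ Q ∈ R.genIn (R.smallMeeting E M) j, Q.vol =
      if j < R.holeGen E then 0 else R.meetVol E j := by
    intro M hM j
    have hle : ∀ Q ∈ R.gen j, (Q.vol ≤ M.vol ↔ R.holeGen E ≤ j) := fun Q hQ => by
      rw [vol_le_vol_iff hd, side_le_side_iff hQ hM.mem_gen]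
    split_ifs with hj
    · refine Finset.sum_eq_zero fun Q hQ => ?_
      rw [mem_genIn] at hQ
      exact absurd ((hle Q hQ.1).1 hQ.2.2) hj.not_ge
    · rw [meetVol]
      congr 1
      ext Q
      rw [mem_genIn, mem_genIn]
      exact and_congr_right fun hQ => and_iff_left ((hle Q hQ).2 (not_lt.1 hj))
  have hsum : ∀ f : ℕ → ℝ, HasSum (fun j => if j < R.holeGen E then 0 else f j) (∑' j,
      (if j < R.holeGen E then 0 else f j)) → (∀ j < R.holeGen E, f j = R.vol) →
      HasSum f (R.holeGen E * R.vol + ∑' j, (if j < R.holeGen E then 0 else f j)) := by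
    intro f hf hfv
    have h1 : HasSum (fun j => if j < R.holeGen E then R.vol else 0) (R.holeGen E * R.vol) := by
      have := hasSum_sum_of_ne_finset_zero (s := Finset.range (R.holeGen E))
        (f := fun j => if j < R.holeGen E then R.vol else 0) (L := .unconditional ℕ)
        (by simp +contextual)
      rw [Finset.sum_congr rfl fun j hj => if_pos (Finset.mem_range.1 hj)] at this
      simpa using this
    convert h1.add hf using 2 with j
    split_ifs with hj
    · rw [hfv j hj, add_zero]
    · rw [zero_add]
  rw [meetingBound_iff]
  constructor
  · rintro ⟨M, hM, h1, h2⟩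
    rw [tsum_eq_tsum_genIn (hS M) h1] at h2
    have h3 := (key M).1 h1
    simp only [hv M hM] at h2 h3
    have h4 := hsum _ h3.hasSum fun j hj => meetVol_eq_vol_of_lt hj
    refine ⟨⟨M, hM⟩, h4.summable, ?_⟩
    rw [h4.tsum_eq]
    linarith
  · rintro ⟨⟨M, hM⟩, h1, h2⟩
    have h3 : Summable fun j => if j < R.holeGen E then 0 else R.meetVol E j := by
      refine h1.of_nonneg_of_le (fun j => ?_) fun j => ?_
      · split_ifs
        exacts [le_rfl, meetVol_nonneg]
      · split_ifs
        exacts [meetVol_nonneg, le_rfl]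
    have h4 := hsum _ h3.hasSum fun j hj => meetVol_eq_vol_of_lt hj
    have h5 : Summable fun Q : R.smallMeeting E M => Q.1.vol := by
      refine (key M).2 ?_
      simpa only [hv M hM] using h3
    refine ⟨M, hM, h5, ?_⟩
    rw [tsum_eq_tsum_genIn (hS M) h5]
    simp only [hv M hM]
    rw [h4.tsum_eq] at h2
    linarith

/-- A bound for the sum over all cubes that meet `E` forces half of `R` to be covered by free
cubes whose generation exceeds `holeGen` by a bounded amount. -/
theorem MeetingBound.meetVol_le_half {C : ℝ} (h : MeetingBound E C R) {N : ℕ}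
    (hN : 2 * C ≤ N) (hN0 : 0 < N) : R.meetVol E (R.holeGen E + N) ≤ R.vol / 2 := by
  obtain ⟨-, h1, h2⟩ := meetingBound_iff.1 h
  have h3 := (h1.sum_le_tsum (Finset.range (R.holeGen E + N)) fun j _ => meetVol_nonneg).trans h2
  rw [Finset.sum_range_add, Finset.sum_congr rfl
    fun j hj => meetVol_eq_vol_of_lt (Finset.mem_range.1 hj), Finset.sum_const,
    Finset.card_range, nsmul_eq_mul] at h3
  have h4 : (N : ℝ) * R.meetVol E (R.holeGen E + N) ≤
      ∑ i ∈ Finset.range N, R.meetVol E (R.holeGen E + i) := by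
    have := Finset.card_nsmul_le_sum (Finset.range N) (fun i => R.meetVol E (R.holeGen E + i))
      (R.meetVol E (R.holeGen E + N)) fun i hi => meetVol_antitone
        (Nat.add_le_add_left (Finset.mem_range.1 hi).le _)
    simpa using this
  have hN' : (0 : ℝ) < N := by exact_mod_cast hN0
  have hR := R.vol_pos
  refine le_of_mul_le_mul_left ?_ hN'
  nlinarith

end Cube

open Cube in
theorem weaklyPorous_of_meetingBound {d : ℕ} (hd : 1 ≤ d) {E : Set (Fin d → ℝ)} {C : ℝ}
    (h : ∀ R : Cube d, MeetingBound E C R) : WeaklyPorous E := by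
  classical
  obtain ⟨N, hN⟩ := exists_nat_ge (2 * C)
  have hN1 : 2 * C ≤ (N + 1 : ℕ) := by push_cast; linarith
  refine ⟨1 / 2, (1 / 2 ^ (N + 1)) ^ d, by norm_num, by norm_num, by positivity, ?_, fun R => ?_⟩
  · refine pow_lt_one₀ (by positivity) ?_ (by omega)
    rw [div_lt_one (by positivity)]
    exact one_lt_pow₀ one_lt_two (by omega)
  obtain ⟨⟨M, hM⟩, -⟩ := meetingBound_iff.1 (h R)
  refine ⟨M, hM, (R.gen (R.holeGen E + (N + 1))).filter fun Q => Q.toSet ∩ E = ∅,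
    fun Q hQ => ?_, fun Q hQ Q' hQ' => ?_, ?_⟩
  · obtain ⟨hQ, hE⟩ := Finset.mem_filter.1 hQ
    refine ⟨mem_dyadic.2 ⟨_, hQ⟩, hE, ?_⟩
    rw [vol_of_mem_gen hQ, vol_of_mem_gen hM.mem_gen, ← mul_pow, pow_add]
    refine le_of_eq ?_
    congr 1
    field_simp
    ring
  · exact disjoint_of_mem_gen (Finset.mem_filter.1 hQ).1 (Finset.mem_filter.1 hQ').1
  · have h1 := (h R).meetVol_le_half hN1 (by omega)
    have h2 := R.sum_vol_gen (R.holeGen E + (N + 1))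
    rw [← Finset.sum_filter_add_sum_filter_not _ fun Q => Q.toSet ∩ E = ∅] at h2
    rw [meetVol_eq_sum_ite, ← Finset.sum_filter] at h1
    simp only [← Set.nonempty_iff_ne_empty, ← ne_eq] at h2
    linarith

namespace Cube

variable {d : ℕ}

/-! ### Doubling of the largest free cube -/

/-- The side length of the largest free cube `M(R)`. -/
noncomputable def holeSide (R : Cube d) (E : Set (Fin d → ℝ)) : ℝ :=
  R.side / 2 ^ R.holeGen E

theorem holeSide_pos (R : Cube d) (E : Set (Fin d → ℝ)) : 0 < R.holeSide E :=
  div_pos R.side_pos (by positivity)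

theorem holeSide_le_side (R : Cube d) (E : Set (Fin d → ℝ)) : R.holeSide E ≤ R.side :=
  div_le_self R.side_pos.le (one_le_pow₀ one_le_two)

/-- A free cube in general position in `R` contains a dyadic cube of `R` of comparable size. -/
theorem side_le_four_mul_holeSide {R Q : Cube d} {E : Set (Fin d → ℝ)}
    (hle : Q.side ≤ R.side) (hl : ∀ i, R.corner i ≤ Q.corner i)
    (hr : ∀ i, Q.corner i + Q.side ≤ R.corner i + R.side) (hE : Q.toSet ∩ E = ∅) :
    Q.side ≤ 4 * R.holeSide E := by
  have hR := R.side_pos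
  have hQ := Q.side_pos
  -- In the first generation with side at most `ℓ(Q) / 2`, the grid point just above the corner of
  -- `Q` in each coordinate is the corner of a dyadic cube contained in `Q`.
  have hex : ∃ j : ℕ, 2 * (R.side / 2 ^ j) ≤ Q.side := by
    obtain ⟨j, hj⟩ := pow_unbounded_of_one_lt (2 * R.side / Q.side) one_lt_two
    refine ⟨j, ?_⟩
    rw [div_lt_iff₀ hQ] at hj
    rw [← mul_div_assoc, div_le_iff₀ (by positivity)]
    linarith
  classical
  obtain ⟨j, hj, hmin⟩ : ∃ j : ℕ, 2 * (R.side / 2 ^ j) ≤ Q.side ∧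
      Q.side ≤ 4 * (R.side / 2 ^ j) := by
    refine ⟨Nat.find hex, Nat.find_spec hex, ?_⟩
    rcases hj : Nat.find hex with _ | n
    · rw [pow_zero]
      linarith
    · have h := not_le.1 (Nat.find_min hex (m := n) (by omega))
      rw [pow_succ]
      refine h.le.trans_eq ?_
      field_simp
      ring
  have hs : 0 < R.side / 2 ^ j := by positivity
  set s := R.side / 2 ^ j with hsdef
  have h0 : ∀ i, 0 ≤ (Q.corner i - R.corner i) / s := fun i =>
    div_nonneg (by linarith [hl i]) hs.le
  have h1 : ∀ i, Q.corner i - R.corner i ≤ ⌈(Q.corner i - R.corner i) / s⌉₊ * s := fun i =>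
    (div_le_iff₀ hs).1 (Nat.le_ceil _)
  have h2 : ∀ i, ⌈(Q.corner i - R.corner i) / s⌉₊ * s < Q.corner i - R.corner i + s := fun i => by
    have h := mul_lt_mul_of_pos_right (Nat.ceil_lt_add_one (h0 i)) hs
    rwa [add_mul, one_mul, div_mul_cancel₀ _ hs.ne'] at h
  have hP : R.sub j (fun i => ⌈(Q.corner i - R.corner i) / s⌉₊) ∈ R.gen j := by
    refine mem_gen_iff_exists.2 ⟨_, fun i => ?_, rfl⟩
    have h3 : (⌈(Q.corner i - R.corner i) / s⌉₊ : ℝ) * s < 2 ^ j * s := by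
      have : 2 ^ j * s = R.side := by rw [hsdef]; field_simp
      linarith [h2 i, hr i]
    exact_mod_cast lt_of_mul_lt_mul_right h3 hs.le
  have hPE : (R.sub j (fun i => ⌈(Q.corner i - R.corner i) / s⌉₊)).toSet ∩ E = ∅ := by
    refine Set.subset_eq_empty (Set.inter_subset_inter_left (t := Q.toSet) E ?_) hE
    intro x hx i
    have h3 := hx i
    simp only [sub, ← hsdef] at h3
    constructor <;> linarith [h1 i, h2 i]
  have h4 : R.side / 2 ^ j ≤ R.holeSide E :=
    div_le_div_of_nonneg_left hR.le (by positivity)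
      (pow_le_pow_right₀ one_le_two (holeGen_le hP hPE))
  linarith

/-- A form of weak porosity: for every cube, the free cubes that are at most `2 ^ b` times smaller
than the largest one cover a fixed proportion. -/
def HoleCover (E : Set (Fin d → ℝ)) (c : ℝ) (b : ℕ) : Prop :=
  ∀ R : Cube d, ∃ F : Finset (Cube d),
    (∀ Q ∈ F, ∃ j ≤ R.holeGen E + b, Q ∈ R.gen j ∧ Q.toSet ∩ E = ∅) ∧
    (∀ Q ∈ F, ∀ Q' ∈ F, Q ≠ Q' → Disjoint Q.toSet Q'.toSet) ∧
    c * R.vol ≤ ∑ Q ∈ F, Q.vol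

theorem exists_holeCover (hd : 1 ≤ d) {E : Set (Fin d → ℝ)} (h : WeaklyPorous E) :
    ∃ c : ℝ, 0 < c ∧ c < 1 ∧ ∃ b, HoleCover E c b := by
  obtain ⟨c, δ, hc, hc1, hδ, hδ1, h⟩ := h
  obtain ⟨b, hb⟩ := exists_pow_lt_of_lt_one hδ (show (1 / 2 : ℝ) < 1 by norm_num)
  refine ⟨c, hc, hc1, b, fun R => ?_⟩
  obtain ⟨M, hM, F, hF, hdisj, hvol⟩ := h R
  refine ⟨F, fun Q hQ => ?_, hdisj, hvol⟩
  obtain ⟨hQR, hQE, hle⟩ := hF Q hQ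
  obtain ⟨j, hj⟩ := mem_dyadic.1 hQR
  refine ⟨j, ?_, hj, hQE⟩
  -- Since `(1 / 2) ^ b < δ ≤ 1`, also `((1 / 2) ^ b) ^ d < δ`, and the `d`-th root can be taken.
  have h1 : ((1 / 2 : ℝ) ^ b * M.side) ^ d ≤ Q.side ^ d := by
    rw [mul_pow, ← vol_eq, ← vol_eq]
    refine le_trans (mul_le_mul_of_nonneg_right ?_ M.vol_pos.le) hle
    exact (pow_le_of_le_one (by positivity) (pow_le_one₀ (by norm_num) (by norm_num))
      (by omega)).trans hb.le
  have h2 := le_of_pow_le_pow_left₀ (by omega) Q.side_pos.le h1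
  rw [hM.side_eq, side_of_mem_gen hj] at h2
  have h3 : R.side / 2 ^ (R.holeGen E + b) ≤ R.side / 2 ^ j := by
    refine le_of_eq_of_le ?_ h2
    rw [pow_add, div_pow, one_pow]
    field_simp
  rw [div_le_div_iff_of_pos_left R.side_pos (by positivity) (by positivity)] at h3
  exact (pow_le_pow_iff_right₀ one_lt_two).1 h3

variable {E : Set (Fin d → ℝ)} {c : ℝ} {b : ℕ}

theorem HoleCover.meetVol_le (h : HoleCover E c b) (R : Cube d) :
    R.meetVol E (R.holeGen E + b) ≤ (1 - c) * R.vol := by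
  obtain ⟨F, hF, hdisj, hvol⟩ := h R
  have h1 := sum_vol_add_sum_vol_le (R := R) hdisj
    (disjoint_of_mem_genIn (R := R) (S := R.meeting E) (j := R.holeGen E + b)) ?_ ?_ ?_
  · change _ + R.meetVol E _ ≤ _ at h1
    linarith
  · intro Q hQ P hP
    obtain ⟨j, hj, hQj, hQE⟩ := hF Q hQ
    obtain ⟨hPj, y, hyP, hyE⟩ := mem_genIn_meeting.1 hP
    refine Set.disjoint_left.2 fun x hxQ hxP => ?_
    obtain ⟨i, hi⟩ := Nat.exists_eq_add_of_le hj
    rw [hi] at hPj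
    have hy := toSet_subset_of_mem_gen (mem_gen_of_mem_gen_add hQj hPj hxQ hxP) hyP
    exact absurd (Set.mem_inter hy hyE) (hQE ▸ Set.notMem_empty y)
  · intro Q hQ
    obtain ⟨j, -, hQj, -⟩ := hF Q hQ
    exact toSet_subset_of_mem_gen hQj
  · intro Q hQ
    exact toSet_subset_of_mem_gen (mem_genIn.1 hQ).1

/-- If `R'` is only slightly larger than `R`, the largest free cube of `R'` is at most a constant
times larger than that of `R`. Otherwise the free cubes that cover a fixed proportion of `R'` are
all too large to reach deep into `R`, so they lie in a thin shell near the boundary of `R'`. -/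
theorem HoleCover.holeSide_le_of_slightly_larger (h : HoleCover E c b) (hc : 0 < c) (hc1 : c < 1)
    {η : ℝ} (hη : 0 < η) (hηc : 21 * d * η < c) (hη1 : 21 * η < 1) {R R' : Cube d}
    (hl : ∀ i, R'.corner i ≤ R.corner i)
    (hr : ∀ i, R.corner i + R.side ≤ R'.corner i + R'.side)
    (hs : R.side ≤ R'.side) (hs' : R'.side ≤ (1 + η) * R.side) :
    R'.holeSide E ≤ (2 / η + 5 * 2 ^ b) * R.holeSide E := by
  have hR := R.side_pos
  have hm := R.holeSide_pos E
  set m := R.holeSide E with hmdef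
  by_contra! hlt
  -- The free cube in `R` is small, for otherwise the trivial bound `ℓ(R')` suffices.
  have hmη : m < η * R.side := by
    by_contra! hge
    have h1 : R'.holeSide E ≤ 2 * R.side := (R'.holeSide_le_side E).trans (by nlinarith)
    have h2 : 2 * R.side ≤ 2 / η * m := by
      rw [div_mul_eq_mul_div, le_div_iff₀ hη]
      linarith
    have h3 : 0 < 5 * 2 ^ b * m := by positivity
    linarith
  have hbig : 5 * 2 ^ b * m < R'.holeSide E := by
    have : 0 < 2 / η * m := by positivity
    linarith
  let I : Cube d := ⟨fun i => R.corner i + 5 * m, R.side - 10 * m, by nlinarith⟩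
  obtain ⟨F, hF, hdisj, hvol⟩ := h R'
  have hI : I.toSet ⊆ R'.toSet := by
    intro x hx i
    have := hx i
    simp only [I] at this
    constructor <;> linarith [hl i, hr i]
  have h1 := sum_vol_add_sum_vol_le (R := R') (F := F) (G := {I}) hdisj (by simp) ?_ ?_
    (by simpa using hI)
  · rw [Finset.sum_singleton, vol_eq I, vol_eq R'] at h1
    rw [vol_eq R'] at hvol
    -- The inner cube fills more than `1 - c` of `R'`, by Bernoulli's inequality.
    have h2 : (1 - 21 * η) * R'.side ≤ R.side - 10 * m := by nlinarith
    have h3 : ((1 - 21 * η) * R'.side) ^ d ≤ (R.side - 10 * m) ^ d :=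
      pow_le_pow_left₀ (mul_nonneg (by linarith) R'.side_pos.le) h2 d
    rw [mul_pow] at h3
    have h4 : 1 - c < (1 - 21 * η) ^ d := by
      have := one_add_mul_le_pow (show (-2 : ℝ) ≤ -(21 * η) by linarith) d
      rw [← sub_eq_add_neg] at this
      linarith
    have h5 := mul_lt_mul_of_pos_right h4 (pow_pos R'.side_pos d)
    simp only [I] at h1
    linarith
  · intro Q hQ P hP
    obtain ⟨j, hj, hQj, hQE⟩ := hF Q hQ
    obtain rfl := Finset.mem_singleton.1 hP
    have hQm : 5 * m < Q.side := by
      have h2 : R'.side / 2 ^ (R'.holeGen E + b) ≤ Q.side := by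
        rw [side_of_mem_gen hQj]
        exact div_le_div_of_nonneg_left R'.side_pos.le (by positivity)
          (pow_le_pow_right₀ one_le_two hj)
      rw [pow_add, ← div_div] at h2
      refine lt_of_lt_of_le ?_ h2
      rw [lt_div_iff₀ (by positivity)]
      exact lt_of_eq_of_lt (by ring) hbig
    refine Set.disjoint_left.2 fun x hxQ hxI => ?_
    -- If `Q` met the inner cube, `Q ∩ R` would contain a free cube of side `5 * m`.
    let S : Cube d := ⟨fun i => max (Q.corner i) (R.corner i), 5 * m, by positivity⟩
    have hSQ : S.toSet ⊆ Q.toSet := by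
      intro y hy i
      have h1 := hxQ i
      have h2 := hxI i
      have h3 := hy i
      simp only [S, I] at h1 h2 h3
      have h4 := le_max_left (Q.corner i) (R.corner i)
      refine ⟨h4.trans h3.1, h3.2.trans_le ?_⟩
      rcases max_choice (Q.corner i) (R.corner i) with h5 | h5 <;> rw [h5] <;> linarith
    have hS := side_le_four_mul_holeSide (R := R) (Q := S) (E := E) (by simp only [S]; nlinarith)
      (fun i => le_max_right _ _) (fun i => ?_)
      (Set.subset_eq_empty (Set.inter_subset_inter_left E hSQ) hQE)
    · simp only [S, ← hmdef] at hS
      linarith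
    · have h1 := hxQ i
      have h2 := hxI i
      simp only [S, I] at h1 h2 ⊢
      rcases max_choice (Q.corner i) (R.corner i) with h5 | h5 <;> rw [h5] <;> nlinarith
  · intro Q hQ
    obtain ⟨j, -, hQj, -⟩ := hF Q hQ
    exact toSet_subset_of_mem_gen hQj

/-- The largest free cube of a cube is at most a constant times larger than that of any of its
dyadic children, by growing the child to its parent in small steps. -/
theorem HoleCover.exists_doubling (h : HoleCover E c b) (hc : 0 < c) (hc1 : c < 1) :
    ∃ a : ℕ, ∀ P Q : Cube d, Q ∈ P.gen 1 →
      Q.holeGen E + 1 ≤ P.holeGen E + a := by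
  obtain ⟨η, hη, hηc, hη1⟩ : ∃ η : ℝ, 0 < η ∧ 21 * d * η < c ∧ 21 * η < 1 := by
    have hd0 : (0 : ℝ) ≤ d := d.cast_nonneg
    refine ⟨c / (21 * d + 21), by positivity, ?_, ?_⟩
    · rw [← mul_div_assoc, div_lt_iff₀ (by positivity)]
      nlinarith
    · rw [← mul_div_assoc, div_lt_one (by positivity)]
      linarith
  obtain ⟨N, hN⟩ := exists_nat_gt (1 / η)
  have hN0 : (0 : ℝ) < N := lt_trans (by positivity) hN
  have hN1 : 1 / (N : ℝ) ≤ η := by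
    rw [div_le_iff₀ hN0]
    rw [div_lt_iff₀ hη] at hN
    linarith
  obtain ⟨e, he⟩ := pow_unbounded_of_one_lt (2 / η + 5 * 2 ^ b) (one_lt_two (α := ℝ))
  refine ⟨e * N, fun P Q hQ => ?_⟩
  have hside : P.side = 2 * Q.side := by
    rw [side_of_mem_gen hQ]
    ring
  have hs := Q.side_pos
  have hl : ∀ i, P.corner i ≤ Q.corner i ∧ Q.corner i + Q.side ≤ P.corner i + 2 * Q.side := by
    obtain ⟨k, hk, rfl⟩ := mem_gen_iff_exists.1 hQ
    intro i
    have h1 : (k i : ℝ) ≤ 1 := by exact_mod_cast Nat.lt_succ_iff.1 (hk i)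
    have h2 : (0 : ℝ) ≤ k i := (k i).cast_nonneg
    simp only [sub] at hs ⊢
    constructor <;> nlinarith
  -- `S 0 = Q`, `S N = P`, and consecutive cubes have side ratio at most `1 + 1 / N ≤ 1 + η`.
  let S : ℕ → Cube d := fun n =>
    ⟨fun i => Q.corner i + n / N * (P.corner i - Q.corner i), (1 + n / N) * Q.side, by positivity⟩
  have hstep : ∀ n, (S n).holeSide E ≤ (2 ^ e) ^ n * Q.holeSide E := by
    intro n
    induction n with
    | zero =>
      have h0 : S 0 = Q := ext_corner_side (by simp [S]) (by simp [S])
      rw [h0, pow_zero, one_mul]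
    | succ n ih =>
      have ht : ((n + 1 : ℕ) : ℝ) / N = n / N + 1 / N := by push_cast; ring
      have hn : (0 : ℝ) ≤ n / N := by positivity
      have hN' : 0 < 1 / (N : ℝ) := by positivity
      have h1 := h.holeSide_le_of_slightly_larger hc hc1 hη hηc hη1 (R := S n) (R' := S (n + 1))
        (fun i => ?_) (fun i => ?_) ?_ ?_
      · calc (S (n + 1)).holeSide E ≤ (2 / η + 5 * 2 ^ b) * (S n).holeSide E := h1
          _ ≤ 2 ^ e * ((2 ^ e) ^ n * Q.holeSide E) :=
            mul_le_mul he.le ih (holeSide_pos _ _).le (by positivity)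
          _ = _ := by ring
      · simp only [S, ht]
        nlinarith [hl i]
      · simp only [S, ht]
        nlinarith [hl i]
      · simp only [S, ht]
        nlinarith
      · simp only [S, ht]
        rw [← mul_assoc]
        refine mul_le_mul_of_nonneg_right ?_ hs.le
        nlinarith
  have hSN : S N = P := by
    refine ext_corner_side (funext fun i => ?_) ?_
    · simp [S, div_self hN0.ne']
    · simp only [S, div_self hN0.ne', hside]
      ring
  have h1 := hstep N
  rw [hSN, holeSide, holeSide, hside, ← pow_mul] at h1
  have h2 : (2 : ℝ) ^ (Q.holeGen E + 1) ≤ 2 ^ (P.holeGen E + e * N) := by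
    rw [div_le_iff₀ (by positivity)] at h1
    have h3 : 2 * Q.side * 2 ^ Q.holeGen E ≤
        (2 ^ (e * N) * (Q.side / 2 ^ Q.holeGen E) * 2 ^ P.holeGen E) * 2 ^ Q.holeGen E :=
      mul_le_mul_of_nonneg_right h1 (by positivity)
    have h4 : (2 ^ (e * N) * (Q.side / 2 ^ Q.holeGen E) * 2 ^ P.holeGen E) * 2 ^ Q.holeGen E
        = Q.side * (2 ^ P.holeGen E * 2 ^ (e * N)) := by
      field_simp
    rw [h4] at h3
    refine le_of_mul_le_mul_left ?_ hs
    rw [pow_succ, pow_add]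
    linarith
  exact (pow_le_pow_iff_right₀ one_lt_two).1 h2
end Cube

namespace Cube

variable {d : ℕ} {E : Set (Fin d → ℝ)}

/-! ### From weak porosity to the bound for the cubes that meet the set -/

/-- The induction behind the main estimate. The parameter `t` is a threshold generation: it drops
by one when passing from a cube to its children, as long as the child still has a free cube of
generation at most `t`. A child without such a free cube is full up to generation `t`; for it the
threshold is raised to the generation `holeGen + b`, which costs at most `a + b` by doubling, and
this is paid for by the proportion `c` that is covered by free cubes. -/
theorem sum_range_meetVol_le {c K : ℝ} {a b : ℕ} (hM : ∀ R : Cube d, ∃ M, R.IsLargestFree E M)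
    (hE : HoleCover E c b)
    (hdbl : ∀ P Q : Cube d, Q ∈ P.gen 1 → Q.holeGen E + 1 ≤ P.holeGen E + a)
    (hK : 0 ≤ K) (hcK : a + b ≤ c * K) (n : ℕ) :
    ∀ (R : Cube d) (t : ℕ), R.holeGen E ≤ t →
      ∑ j ∈ Finset.range n, R.meetVol E j ≤ t * R.vol + K * R.meetVol E t := by
  induction n with
  | zero =>
    intro R t _
    rw [Finset.sum_range_zero]
    exact add_nonneg (mul_nonneg t.cast_nonneg R.vol_pos.le) (mul_nonneg hK meetVol_nonneg)
  | succ n ih =>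
    rintro R (_ | t) ht
    · obtain ⟨Q, hQ, hQE⟩ := exists_mem_gen_holeGen (hM R)
      rw [Nat.le_zero.1 ht, gen_zero, Finset.mem_singleton] at hQ
      subst hQ
      simp [meetVol_eq_zero hQE]
    · have hchild : ∀ Q ∈ R.gen 1,
          ∑ j ∈ Finset.range n, Q.meetVol E j ≤ t * Q.vol + K * Q.meetVol E t := by
        intro Q hQ
        by_cases hp : Q.holeGen E ≤ t
        · exact ih Q t hp
        · have h1 := ih Q (Q.holeGen E + b) (Nat.le_add_right _ _)
          have h2 := mul_le_mul_of_nonneg_left (hE.meetVol_le Q) hK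
          have h3 : ((Q.holeGen E + b : ℕ) : ℝ) ≤ t + c * K := by
            have h4 : Q.holeGen E ≤ t + a := by
              have := hdbl R Q hQ
              omega
            have h5 : (Q.holeGen E : ℝ) ≤ t + a := by exact_mod_cast h4
            push_cast
            linarith
          have h4 := mul_le_mul_of_nonneg_right h3 Q.vol_pos.le
          rw [meetVol_eq_vol_of_lt (not_le.1 hp)]
          linarith
      calc ∑ j ∈ Finset.range (n + 1), R.meetVol E j
          = ∑ j ∈ Finset.range n, R.meetVol E (1 + j) + R.meetVol E 0 := by
            rw [Finset.sum_range_succ']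
            simp only [add_comm 1]
        _ = ∑ Q ∈ R.gen 1, ∑ j ∈ Finset.range n, Q.meetVol E j + R.meetVol E 0 := by
            simp only [meetVol_add (i := 1)]
            rw [Finset.sum_comm]
        _ ≤ ∑ Q ∈ R.gen 1, (t * Q.vol + K * Q.meetVol E t) + R.vol :=
            add_le_add (Finset.sum_le_sum hchild) meetVol_le_vol
        _ = ((t + 1 : ℕ) : ℝ) * R.vol + K * R.meetVol E (t + 1) := by
            rw [Finset.sum_add_distrib, ← Finset.mul_sum, ← Finset.mul_sum, sum_vol_gen,
              ← meetVol_add, add_comm 1]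
            push_cast
            ring

end Cube

open Cube in
theorem WeaklyPorous.exists_meetingBound {d : ℕ} (hd : 1 ≤ d) {E : Set (Fin d → ℝ)}
    (h : WeaklyPorous E) : ∃ C : ℝ, ∀ R : Cube d, MeetingBound E C R := by
  have hM : ∀ R : Cube d, ∃ M, R.IsLargestFree E M := by
    obtain ⟨c, δ, -, -, -, -, h⟩ := h
    exact fun R => (h R).imp fun M hM => hM.1
  obtain ⟨c, hc, hc1, b, hE⟩ := exists_holeCover hd h
  obtain ⟨a, hdbl⟩ := hE.exists_doubling hc hc1
  have hK : (0 : ℝ) ≤ (a + b) / c := by positivity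
  refine ⟨(a + b) / c, fun R => ?_⟩
  have hsum : ∀ n, ∑ j ∈ Finset.range n, R.meetVol E j ≤
      (R.holeGen E + (a + b) / c) * R.vol := fun n => by
    have h1 := sum_range_meetVol_le hM hE hdbl hK (by rw [mul_div_cancel₀ _ hc.ne']) n R _ le_rfl
    have h2 := mul_le_mul_of_nonneg_left (meetVol_le_vol (R := R) (E := E) (j := R.holeGen E)) hK
    linarith
  exact meetingBound_iff.2 ⟨hM R, summable_of_sum_range_le (fun _ => meetVol_nonneg) hsum,
    Real.tsum_le_of_sum_range_le (fun _ => meetVol_nonneg) hsum⟩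

namespace Cube

variable {d : ℕ} {E : Set (Fin d → ℝ)} {R Q P : Cube d} {j : ℕ}

/-! ### The measure of the closure -/

theorem volume_closure_inter_le (R : Cube d) (E : Set (Fin d → ℝ)) (j : ℕ) :
    volume (closure (E ∩ R.toSet)) ≤ ENNReal.ofReal (R.meetVol E j) := by
  have h1 : closure (E ∩ R.toSet) ⊆ ⋃ Q ∈ R.genIn (R.meeting E) j,
      Set.Icc Q.corner (fun i => Q.corner i + Q.side) := by
    refine closure_minimal ?_ (isClosed_biUnion_finset fun Q _ => isClosed_Icc)
    rintro x ⟨hxE, hxR⟩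
    obtain ⟨Q, hQ, hxQ⟩ := exists_mem_gen_of_mem hxR j
    exact Set.mem_biUnion (mem_genIn_meeting.2 ⟨hQ, x, hxQ, hxE⟩)
      ⟨fun i => (hxQ i).1, fun i => (hxQ i).2.le⟩
  refine (measure_mono h1).trans ((measure_biUnion_finset_le _ _).trans_eq ?_)
  rw [meetVol, ENNReal.ofReal_sum_of_nonneg fun Q _ => Q.vol_pos.le]
  refine Finset.sum_congr rfl fun Q _ => ?_
  rw [Real.volume_Icc_pi, vol_eq]
  simp [ENNReal.ofReal_pow Q.side_pos.le]

theorem volume_closure_eq_zero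
    (h : ∀ R : Cube d, Filter.Tendsto (R.meetVol E) Filter.atTop (nhds 0)) :
    volume (closure E) = 0 := by
  let S : ℕ → Cube d := fun n => ⟨fun _ => -(n + 1), 2 * (n + 1), by positivity⟩
  have hS : ∀ n, volume (closure (E ∩ (S n).toSet)) = 0 := fun n => by
    have hlim := (ENNReal.continuous_ofReal.tendsto 0).comp (h (S n))
    rw [ENNReal.ofReal_zero] at hlim
    exact le_antisymm (ge_of_tendsto' hlim fun j => volume_closure_inter_le (S n) E j) zero_le
  refine measure_mono_null (fun x hx => ?_) (measure_iUnion_null hS)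
  obtain ⟨n, hn⟩ := exists_nat_gt ‖x‖
  have hball : x ∈ Metric.ball (0 : Fin d → ℝ) (n + 1) := by
    rw [mem_ball_zero_iff]
    linarith
  refine Set.mem_iUnion.2 ⟨n, closure_mono ?_ (Metric.isOpen_ball.inter_closure ⟨hball, hx⟩)⟩
  rintro y ⟨hy, hyE⟩
  refine ⟨hyE, fun i => ?_⟩
  rw [mem_ball_zero_iff] at hy
  have := abs_lt.1 ((norm_le_pi_norm y i).trans_lt hy)
  simp only [S]
  constructor <;> linarith

/-- If the closure of `E` is a null set, almost every point of `R` lies in a free cube. -/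
theorem tendsto_meetVol (h : volume (closure E) = 0) (R : Cube d) :
    Filter.Tendsto (R.meetVol E) Filter.atTop (nhds 0) := by
  let W : ℕ → Set (Fin d → ℝ) := fun j => ⋃ Q ∈ R.genIn (R.meeting E) j, Q.toSet
  have hWR : ∀ j, W j ⊆ R.toSet := fun j =>
    Set.iUnion₂_subset fun Q hQ => toSet_subset_of_mem_gen (mem_genIn.1 hQ).1
  have hanti : Antitone W := by
    refine antitone_nat_of_succ_le fun j x hx => ?_
    simp only [W, Set.mem_iUnion, mem_genIn_meeting] at hx ⊢
    obtain ⟨Q, ⟨hQ, y, hyQ, hyE⟩, hxQ⟩ := hx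
    obtain ⟨P, hP, hxP⟩ := exists_mem_gen_of_mem (toSet_subset_of_mem_gen hQ hxQ) j
    exact ⟨P, ⟨hP, y, toSet_subset_of_mem_gen (mem_gen_of_mem_gen_add hP hQ hxP hxQ) hyQ, hyE⟩,
      hxP⟩
  have hinter : ⋂ j, W j ⊆ closure E := by
    intro x hx
    refine Metric.mem_closure_iff.2 fun ε hε => ?_
    obtain ⟨j, hj⟩ := pow_unbounded_of_one_lt (R.side / ε) one_lt_two
    have hxj := Set.mem_iInter.1 hx j
    simp only [W, Set.mem_iUnion, mem_genIn_meeting] at hxj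
    obtain ⟨Q, ⟨hQ, y, hyQ, hyE⟩, hxQ⟩ := hxj
    refine ⟨y, hyE, (dist_pi_lt_iff hε).2 fun i => ?_⟩
    have hs : Q.side < ε := by
      rw [side_of_mem_gen hQ, div_lt_iff₀ (by positivity)]
      rw [div_lt_iff₀ hε] at hj
      linarith
    rw [Real.dist_eq, abs_lt]
    constructor <;> linarith [hxQ i, hyQ i]
  have hlim := tendsto_measure_iInter_atTop (μ := volume) (s := W)
    (fun j => (Finset.measurableSet_biUnion _ fun Q _ => Q.measurableSet_toSet).nullMeasurableSet)
    hanti ⟨0, measure_ne_top_of_subset (hWR 0) R.volume_toSet_ne_top⟩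
  rw [measure_mono_null hinter h] at hlim
  have h2 := (ENNReal.tendsto_toReal ENNReal.zero_ne_top).comp hlim
  refine h2.congr fun j => ?_
  exact measureReal_biUnion_toSet disjoint_of_mem_genIn

/-! ### The maximal free cubes -/

/-- The total volume of the maximal free cubes of generation `j`. -/
noncomputable def freeVol (R : Cube d) (E : Set (Fin d → ℝ)) (j : ℕ) : ℝ :=
  ∑ Q ∈ R.genIn (R.maximalFree E) j, Q.vol

theorem mem_maximalFree_iff_of_mem_gen_one (hd : 1 ≤ d) (hP : P ∈ R.gen j) (hQ : Q ∈ P.gen 1) :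
    Q ∈ R.maximalFree E ↔ Q.toSet ∩ E = ∅ ∧ (P.toSet ∩ E).Nonempty := by
  have hQR := mem_gen_add hP hQ
  have hQP := toSet_subset_of_mem_gen hQ
  constructor
  · rintro ⟨-, hQE, hmax⟩
    refine ⟨hQE, hmax P (mem_dyadic.2 ⟨j, hP⟩) ⟨hQP, fun hPQ => ?_⟩⟩
    have h1 : P.vol ≤ Q.vol := ENNReal.toReal_mono Q.volume_toSet_ne_top (measure_mono hPQ)
    rw [vol_le_vol_iff hd, side_of_mem_gen hQ] at h1
    linarith [P.side_pos]
  · rintro ⟨hQE, hPE⟩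
    refine ⟨mem_dyadic.2 ⟨_, hQR⟩, hQE, fun P' hP' hlt => ?_⟩
    obtain ⟨i, hi⟩ := mem_dyadic.1 hP'
    have hxP' := hlt.1 Q.corner_mem
    rcases le_or_gt i j with hij | hij
    · obtain ⟨m, rfl⟩ := Nat.exists_eq_add_of_le hij
      exact hPE.mono (Set.inter_subset_inter_left E
        (toSet_subset_of_mem_gen (mem_gen_of_mem_gen_add hi hP hxP' (hQP Q.corner_mem))))
    · obtain ⟨m, rfl⟩ := Nat.exists_eq_add_of_le hij
      exact absurd (toSet_subset_of_mem_gen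
        (mem_gen_of_mem_gen_add hQR hi Q.corner_mem hxP')) hlt.2

theorem self_mem_maximalFree_iff : R ∈ R.maximalFree E ↔ R.toSet ∩ E = ∅ := by
  refine ⟨fun h => h.2.1, fun h => ⟨mem_dyadic.2 ⟨0, R.self_mem_gen_zero⟩, h, fun P hP hlt => ?_⟩⟩
  obtain ⟨i, hi⟩ := mem_dyadic.1 hP
  exact absurd (toSet_subset_of_mem_gen hi) hlt.2

theorem freeVol_eq_sum_ite [DecidablePred (· ∈ R.maximalFree E)] :
    R.freeVol E j = ∑ Q ∈ R.gen j, if Q ∈ R.maximalFree E then Q.vol else 0 := by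
  rw [freeVol, ← Finset.sum_filter]
  congr 1
  ext Q
  rw [mem_genIn, Finset.mem_filter]

theorem meetVol_zero_add_freeVol_zero : R.meetVol E 0 + R.freeVol E 0 = R.vol := by
  classical
  rw [meetVol_eq_sum_ite, freeVol_eq_sum_ite, gen_zero, Finset.sum_singleton,
    Finset.sum_singleton, self_mem_maximalFree_iff, Set.nonempty_iff_ne_empty]
  split_ifs <;> simp_all

theorem meetVol_succ_add_freeVol_succ (hd : 1 ≤ d) :
    R.meetVol E (j + 1) + R.freeVol E (j + 1) = R.meetVol E j := by
  classical
  rw [freeVol_eq_sum_ite, sum_gen_add, meetVol_add, ← Finset.sum_add_distrib,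
    meetVol_eq_sum_ite (j := j)]
  refine Finset.sum_congr rfl fun P hP => ?_
  rw [Finset.sum_congr rfl fun Q hQ => by rw [mem_maximalFree_iff_of_mem_gen_one hd hP hQ],
    meetVol_eq_sum_ite, ← Finset.sum_add_distrib]
  split_ifs with h
  · rw [← P.sum_vol_gen 1]
    refine Finset.sum_congr rfl fun Q _ => ?_
    rw [Set.nonempty_iff_ne_empty]
    split_ifs <;> simp_all
  · refine Finset.sum_eq_zero fun Q hQ => ?_
    have hQE : ¬ (Q.toSet ∩ E).Nonempty := fun hn =>
      h (hn.mono (Set.inter_subset_inter_left E (toSet_subset_of_mem_gen hQ)))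
    simp [hQE, h]

end Cube

/-- Summation by parts for a nonnegative sequence `v` that decreases to `0`. -/
theorem summable_and_tsum_nat_mul_sub {v f : ℕ → ℝ} (hv0 : ∀ j, 0 ≤ v j) (hv : Antitone v)
    (hlim : Filter.Tendsto v Filter.atTop (nhds 0)) (hf : ∀ j, v (j + 1) + f (j + 1) = v j) :
    (Summable v ↔ Summable fun j : ℕ => j * f j) ∧
      (Summable v → ∑' j : ℕ, j * f j = ∑' j, v j) := by
  have hpos : ∀ j : ℕ, 0 ≤ j * f j := by
    rintro (_ | j)
    · simp
    · exact mul_nonneg (Nat.cast_nonneg _) (by linarith [hf j, hv j.le_succ])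
  have habel : ∀ n, ∑ j ∈ Finset.range (n + 1), j * f j + n * v n = ∑ j ∈ Finset.range n, v j := by
    intro n
    induction n with
    | zero => simp
    | succ n ih =>
      rw [Finset.sum_range_succ, Finset.sum_range_succ v, ← ih, ← hf n]
      push_cast
      ring
  have h1 : Summable v → ∀ n, ∑ j ∈ Finset.range n, j * f j ≤ ∑' j, v j := by
    intro hs n
    refine (Finset.sum_le_sum_of_subset_of_nonneg (Finset.range_mono n.le_succ)
      fun j _ _ => hpos j).trans (le_trans ?_ (hs.sum_le_tsum (Finset.range n) fun j _ => hv0 j))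
    linarith [habel n, mul_nonneg (Nat.cast_nonneg (α := ℝ) n) (hv0 n)]
  have h2 : (Summable fun j : ℕ => j * f j) →
      ∀ n, ∑ j ∈ Finset.range n, v j ≤ ∑' j : ℕ, j * f j := by
    intro hs n
    have hm : ∀ᶠ m in Filter.atTop,
        ∑ j ∈ Finset.range n, v j ≤ ∑' j : ℕ, j * f j + n * v m := by
      filter_upwards [Filter.eventually_ge_atTop n] with m hnm
      obtain ⟨k, rfl⟩ := Nat.exists_eq_add_of_le hnm
      have h3 := hs.sum_le_tsum (Finset.range (n + k + 1)) fun j _ => hpos j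
      have h4 := habel (n + k)
      have h5 := Finset.card_nsmul_le_sum (Finset.range k) (fun i => v (n + i)) (v (n + k))
        fun i hi => hv (Nat.add_le_add_left (Finset.mem_range.1 hi).le n)
      rw [Finset.card_range, nsmul_eq_mul] at h5
      rw [Finset.sum_range_add v] at h4
      push_cast at h3 h4
      linarith
    refine ge_of_tendsto ?_ hm
    simpa using (hlim.const_mul (n : ℝ)).const_add (∑' j : ℕ, j * f j)
  have h3 : Summable v → Summable fun j : ℕ => j * f j := fun hs =>
    summable_of_sum_range_le hpos (h1 hs)
  exact ⟨⟨h3, fun hs => summable_of_sum_range_le hv0 (h2 hs)⟩, fun hs =>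
    le_antisymm (Real.tsum_le_of_sum_range_le hpos (h1 hs))
      (Real.tsum_le_of_sum_range_le hv0 (h2 (h3 hs)))⟩

namespace Cube

variable {d : ℕ} {E : Set (Fin d → ℝ)} {R : Cube d}

theorem hasSum_freeVol (hd : 1 ≤ d) (hlim : Filter.Tendsto (R.meetVol E) Filter.atTop (nhds 0)) :
    HasSum (R.freeVol E) R.vol := by
  have hpart : ∀ n, ∑ j ∈ Finset.range (n + 1), R.freeVol E j = R.vol - R.meetVol E n := by
    intro n
    induction n with
    | zero => simp [← meetVol_zero_add_freeVol_zero (R := R) (E := E)]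
    | succ n ih =>
      rw [Finset.sum_range_succ, ih]
      linarith [meetVol_succ_add_freeVol_succ hd (R := R) (E := E) (j := n)]
  have hnonneg : ∀ j, 0 ≤ R.freeVol E j := fun j => Finset.sum_nonneg fun Q _ => Q.vol_pos.le
  rw [hasSum_iff_tendsto_nat_of_nonneg hnonneg,
    ← Filter.tendsto_add_atTop_iff_nat 1]
  simp only [hpart]
  simpa using hlim.const_sub R.vol

/-- A maximal free cube of generation `j` has exactly `j` dyadic ancestors that meet `E`, and the
maximal free cubes cover almost all of `R`. Hence the sum over the maximal free cubes is, up to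
the factor `log 2` and the scaling by `ℓ(R)`, the sum over the cubes that meet `E`. -/
theorem discreteBLO_iff_meetingBound (hd : 1 ≤ d)
    (hlim : Filter.Tendsto (R.meetVol E) Filter.atTop (nhds 0)) {C : ℝ} :
    DiscreteBLO E C R ↔ MeetingBound E (C / Real.log 2) R := by
  have hlog : 0 < Real.log 2 := Real.log_pos one_lt_two
  have hR := R.side_pos
  have hS : R.maximalFree E ⊆ R.dyadic := fun Q hQ => hQ.1
  have hvol := hasSum_freeVol hd hlim
  have hvol1 : Summable fun Q : R.maximalFree E => Q.1.vol :=
    (summable_iff_summable_genIn hS (f := vol) fun Q _ => Q.vol_pos.le).2 hvol.summable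
  have hvol2 : ∑' Q : R.maximalFree E, Q.1.vol = R.vol :=
    (tsum_eq_tsum_genIn hS hvol1).trans hvol.tsum_eq
  have hgen : ∀ j, ∑ Q ∈ R.genIn (R.maximalFree E) j, Q.vol * Real.log (R.side / Q.side) =
      Real.log 2 * (j * R.freeVol E j) := by
    intro j
    rw [freeVol, Finset.mul_sum, Finset.mul_sum]
    refine Finset.sum_congr rfl fun Q hQ => ?_
    rw [side_of_mem_gen (mem_genIn.1 hQ).1, div_div_cancel₀ hR.ne', Real.log_pow]
    ring
  have hnonneg : ∀ Q ∈ R.maximalFree E, 0 ≤ Q.vol * Real.log (R.side / Q.side) := by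
    intro Q hQ
    obtain ⟨j, hj⟩ := mem_dyadic.1 (hS hQ)
    rw [side_of_mem_gen hj, div_div_cancel₀ hR.ne', Real.log_pow]
    exact mul_nonneg Q.vol_pos.le (by positivity)
  have hkey := summable_iff_summable_genIn hS hnonneg
  have hterm : ∀ Q : Cube d, Q.vol * Real.log (1 / Q.side) =
      Q.vol * Real.log (R.side / Q.side) - Real.log R.side * Q.vol := by
    intro Q
    rw [Real.log_div one_ne_zero Q.side_pos.ne', Real.log_div hR.ne' Q.side_pos.ne', Real.log_one]
    ring
  obtain ⟨habel1, habel2⟩ := summable_and_tsum_nat_mul_sub (fun _ => meetVol_nonneg)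
    meetVol_antitone hlim fun j => meetVol_succ_add_freeVol_succ hd (R := R) (E := E) (j := j)
  simp only [hgen, summable_mul_left_iff hlog.ne', ← habel1] at hkey
  have hbound : ∀ M, R.IsLargestFree E M → Summable (R.meetVol E) →
      (∑' Q : R.maximalFree E, Q.1.vol * Real.log (1 / Q.1.side)
        ≤ (Real.log (1 / M.side) + C) * R.vol ↔
      ∑' j, R.meetVol E j ≤ (R.holeGen E + C / Real.log 2) * R.vol) := by
    intro M hM hs
    have h1 := hkey.2 hs
    have h2 : Real.log (1 / M.side) = Real.log 2 * R.holeGen E - Real.log R.side := by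
      rw [hM.side_eq, one_div_div, Real.log_div (by positivity) hR.ne', Real.log_pow]
      ring
    have h3 : ∑' Q : R.maximalFree E, Q.1.vol * Real.log (1 / Q.1.side) =
        Real.log 2 * ∑' j, R.meetVol E j - Real.log R.side * R.vol := by
      rw [tsum_congr fun Q : R.maximalFree E => hterm Q.1,
        h1.tsum_sub (hvol1.mul_left (Real.log R.side)), tsum_mul_left, hvol2,
        tsum_eq_tsum_genIn hS (f := fun Q => Q.vol * Real.log (R.side / Q.side)) h1,
        tsum_congr hgen, tsum_mul_left, habel2 hs]
    have h4 : Real.log 2 * ((R.holeGen E + C / Real.log 2) * R.vol) =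
        (Real.log 2 * R.holeGen E + C) * R.vol := by
      field_simp
    rw [h2, h3]
    refine Iff.trans ?_ (mul_le_mul_iff_right₀ hlog)
    rw [h4]
    constructor <;> intro h <;> linarith
  rw [meetingBound_iff]
  constructor
  · rintro ⟨M, hM, h1, h2⟩
    have h3 : Summable (R.meetVol E) := by
      refine hkey.1 ((h1.add (hvol1.mul_left (Real.log R.side))).congr fun Q => ?_)
      rw [hterm]
      ring
    exact ⟨⟨M, hM⟩, h3, (hbound M hM h3).1 h2⟩
  · rintro ⟨⟨M, hM⟩, h1, h2⟩
    refine ⟨M, hM, ?_, (hbound M hM h1).2 h2⟩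
    simp only [hterm]
    exact (hkey.2 h1).sub (hvol1.mul_left _)

theorem tendsto_meetVol_of_meetingBound {C : ℝ} (h : MeetingBound E C R) :
    Filter.Tendsto (R.meetVol E) Filter.atTop (nhds 0) :=
  (meetingBound_iff.1 h).2.1.tendsto_atTop_zero

end Cube

theorem MeetingBound.mono {d : ℕ} {E : Set (Fin d → ℝ)} {R : Cube d} {C C' : ℝ}
    (h : MeetingBound E C R) (hC : C ≤ C') : MeetingBound E C' R := by
  obtain ⟨M, hM, h1, h2⟩ := h
  refine ⟨M, hM, h1, h2.trans (mul_le_mul_of_nonneg_right ?_ R.vol_pos.le)⟩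
  linarith

open Cube in
theorem mainTheorem1 (d : ℕ) (hd : 1 ≤ d) (E : Set (Fin d → ℝ)) :
    List.TFAE [
      WeaklyPorous E,
      (volume (closure E) = 0 ∧ ∃ C : ℝ, ∀ R : Cube d, DiscreteBLO E C R),
      (∃ C : ℝ, ∀ R : Cube d, MeetingBound E C R),
      (∃ C : ℝ, ∀ R : Cube d, SmallMeetingBound E C R),
      (∃ C : ℝ, ∀ R : Cube d,
        DiscreteBLO E C R ∧ MeetingBound E C R ∧ SmallMeetingBound E C R)] := by
  have hlog : 0 < Real.log 2 := Real.log_pos one_lt_two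
  tfae_have 1 → 3 := fun h => h.exists_meetingBound hd
  tfae_have 3 → 1 := fun ⟨C, h⟩ => weaklyPorous_of_meetingBound hd h
  tfae_have 4 → 3 := fun ⟨C, h⟩ =>
    ⟨C, fun R => (smallMeetingBound_iff_meetingBound hd).1 (h R)⟩
  tfae_have 2 → 3 := fun ⟨hE, C, h⟩ => ⟨C / Real.log 2, fun R =>
    (discreteBLO_iff_meetingBound hd (tendsto_meetVol hE R)).1 (h R)⟩
  tfae_have 5 → 4 := fun ⟨C, h⟩ => ⟨C, fun R => (h R).2.2⟩
  tfae_have 5 → 2 := fun ⟨C, h⟩ =>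
    ⟨volume_closure_eq_zero fun R => tendsto_meetVol_of_meetingBound (h R).2.1,
      C, fun R => (h R).1⟩
  tfae_have 3 → 5 := by
    rintro ⟨C, h⟩
    have h' : ∀ R : Cube d, MeetingBound E |C| R := fun R => (h R).mono (le_abs_self C)
    -- `log 2 ≤ 1`, so the constant `|C|` serves for the natural logarithm as well.
    have hC : |C| ≤ |C| / Real.log 2 := by
      rw [le_div_iff₀ hlog]
      exact mul_le_of_le_one_right (abs_nonneg C) (by linarith [Real.log_two_lt_d9])
    exact ⟨|C|, fun R => ⟨(discreteBLO_iff_meetingBound hd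
      (tendsto_meetVol_of_meetingBound (h R))).2 ((h' R).mono hC), h' R,
      (smallMeetingBound_iff_meetingBound hd).2 (h' R)⟩⟩
  tfae_finish
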